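/- Let $d \ge 0$ be an integer, and call a subset of $\mathbb{R}^d$ proper $d$-dimensional if it is not contained in any affine hyperplane, that is, in any set $\{x \in \mathbb{R}^d : f(x) = c\}$ with $f$ a nonzero linear functional on $\mathbb{R}^d$ and $c \in \mathbb{R}$. Let $A, B \subset \mathbb{R}^d$ be finite sets with $|A| = m$. Assume that $B$ is proper $d$-dimensional and that $A \subset \operatorname{conv} B$, where $\operatorname{conv} B$ is the convex hull of $B$. Then the sumset $A + B = \{a + b : a \in A,\ b \in B\}$ satisfies $$ |A+B| \ge m(d+1) - \frac{d(d+1)}{2}. $$ -/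

import Mathlib

open scoped Pointwise

/-- An affine hyperplane of `ℝ^d`: a level set of a nonzero linear functional. -/
def IsAffineHyperplane {d : ℕ} (H : Set (EuclideanSpace ℝ (Fin d))) : Prop :=
  ∃ (f : EuclideanSpace ℝ (Fin d) →ₗ[ℝ] ℝ) (c : ℝ), f ≠ 0 ∧ H = {x | f x = c}

/-- A subset of `ℝ^d` is proper `d`-dimensional if no affine hyperplane contains it. -/
def IsProperDimensional {d : ℕ} (B : Set (EuclideanSpace ℝ (Fin d))) : Prop :=
  ∀ H : Set (EuclideanSpace ℝ (Fin d)), IsAffineHyperplane H → ¬ B ⊆ H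

/-!
Placing `B` on the hyperplane `V × {1}` of `V × K` turns its convex hull into the section of a
cone. Generic heights on `B` give a regular triangulation of that cone: its cells are the sets of
constraints active at the vertices of the polyhedron of functionals lying below the heights, and
genericity makes them linearly independent. Fix a cell `T₀`, and choose for each `a ∈ A` a cell
`T a` that contains `a` together with an initial piece of the ray from `a` towards the barycentre of
`T₀`. As every cell has `r` elements, `r` being the rank of the span of the lifted `B`, there are
`r * #A` pairs `(a, b)` with `b ∈ T a`. By uniqueness of conic representations, `a + b = a' + b'`
with `b ≠ b'` forces `(a', b') = (b, a)`. Representing `a + b + δ z`, where `z` is the sum of `T₀`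
and `δ` is small, in both `T a` and `T b` then shows that `T a = T₀`, so `a` and `b` both lie in
`T₀`. Hence at most `r.choose 2` sums are counted twice.
-/

open Finset Module PointedCone Submodule
open Finsupp (linearCombination single supported)

section Counting

theorem card_filter_lt_le_choose_two {α : Type*} [LinearOrder α] (T : Finset α) :
    #{p ∈ T ×ˢ T | p.1 < p.2} ≤ (#T).choose 2 := by
  rw [← Sym2.card_image_offDiag]
  refine card_le_card_of_injOn Sym2.mk.uncurry (fun p hp ↦ ?_) fun p hp q hq hpq ↦ ?_
  · simp only [coe_filter, mem_product, Set.mem_ofPred_eq] at hp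
    exact mem_image_of_mem _ (mem_offDiag.2 ⟨hp.1.1, hp.1.2, hp.2.ne⟩)
  · simp only [coe_filter, mem_product, Set.mem_ofPred_eq] at hp hq
    rcases Sym2.eq_iff.1 hpq with ⟨h₁, h₂⟩ | ⟨h₁, h₂⟩
    · exact Prod.ext h₁ h₂
    · exact absurd (h₁ ▸ h₂ ▸ hp.2) hq.2.not_gt

theorem card_le_card_image_add_choose_two {α β : Type*} [DecidableEq β] {S : Finset (α × α)}
    {T : Finset α} {f : α × α → β}
    (hf : ∀ p ∈ S, ∀ q ∈ S, f p = f q → p = q ∨ p.swap = q ∧ p ∈ T ×ˢ T) :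
    #S ≤ #(S.image f) + (#T).choose 2 := by
  classical
  let _ : LinearOrder α := linearOrderOfSTO WellOrderingRel
  set D : Finset (α × α) := {p ∈ T ×ˢ T | p.1 < p.2} with hD
  have hinj : Set.InjOn f (S \ D : Finset (α × α)) := by
    intro p hp q hq hpq
    simp only [coe_sdiff, Set.mem_sdiff, mem_coe, hD, mem_filter, not_and, not_lt] at hp hq
    obtain rfl | ⟨rfl, hpT⟩ := hf p hp.1 q hq.1 hpq
    · rfl
    · have hqT : p.swap ∈ T ×ˢ T := by simpa [and_comm] using hpT
      have heq : p.1 = p.2 := le_antisymm (hq.2 hqT) (hp.2 hpT)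
      exact Prod.ext heq heq.symm
  calc #S ≤ #(S \ D) + #D := card_le_card_sdiff_add_card
    _ = #((S \ D).image f) + #D := by rw [card_image_of_injOn hinj]
    _ ≤ #(S.image f) + (#T).choose 2 := by
      gcongr
      · exact sdiff_subset
      · exact card_filter_lt_le_choose_two T

end Counting

section Finsupp

variable {α M : Type*} [PartialOrder M]

theorem single_le_of_add_single_eq [AddCommMonoid M] [IsOrderedAddMonoid M] {c c' : α →₀ M}
    {b b' : α} {r r' : M} (hc : 0 ≤ c) (hc' : 0 ≤ c')
    (heq : c + single b r = c' + single b' r') (hne : b ≠ b') : single b' r' ≤ c := by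
  classical
  intro t
  rcases eq_or_ne t b with rfl | htb
  · rw [Finsupp.single_eq_of_ne hne]
    exact hc t
  · have ht : c t = c' t + single b' r' t := by
      simpa [Finsupp.single_eq_of_ne htb] using DFunLike.congr_fun heq t
    exact ht ▸ le_add_of_nonneg_left (hc' t)

theorem eq_of_le_of_degree_eq [AddCommGroup M] [IsOrderedAddMonoid M] {c c' : α →₀ M}
    (hle : c' ≤ c) (hdeg : c'.degree = c.degree) : c' = c := by
  have hnonneg : ∀ t ∈ (c - c').support, 0 ≤ (c - c') t := fun t _ ↦ sub_nonneg.2 (hle t)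
  have hsum : ∑ t ∈ (c - c').support, (c - c') t = 0 := by
    rw [← Finsupp.degree_apply, map_sub, hdeg, sub_self]
  ext t
  by_contra hne
  have hdiff : (c - c') t ≠ 0 := sub_ne_zero.2 (Ne.symm hne)
  exact hdiff ((sum_eq_zero_iff_of_nonneg hnonneg).1 hsum t (Finsupp.mem_support_iff.2 hdiff))

end Finsupp

section VectorSpan

variable {K V : Type*} [Field K] [AddCommGroup V] [Module K V]

theorem finrank_span_eq_finrank_vectorSpan_add_one {s : Set V}
    [FiniteDimensional K (vectorSpan K s)] {ℓ : Dual K V} (hℓ : ∀ x ∈ s, ℓ x = 1)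
    (hs : s.Nonempty) :
    finrank K (span K s) = finrank K (vectorSpan K s) + 1 := by
  obtain ⟨p, hp⟩ := hs
  have hp0 : p ≠ 0 := fun h ↦ by simpa [h] using hℓ p hp
  have hker : vectorSpan K s ≤ LinearMap.ker ℓ := span_le.2 <| by
    rintro _ ⟨x, hx, y, hy, rfl⟩
    simp [hℓ x hx, hℓ y hy]
  have hdisj : Disjoint (vectorSpan K s) (span K {p}) :=
    (disjoint_span_singleton' hp0).2 fun hmem ↦ by simpa [hℓ p hp] using hker hmem
  have hsup : vectorSpan K s ⊔ span K {p} = span K s := by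
    refine le_antisymm (sup_le (span_le.2 ?_) (span_mono (Set.singleton_subset_iff.2 hp)))
      (span_le.2 fun x hx ↦ ?_)
    · rintro _ ⟨x, hx, y, hy, rfl⟩
      exact sub_mem (subset_span hx) (subset_span hy)
    · rw [← sub_add_cancel x p]
      exact add_mem_sup (vsub_mem_vectorSpan K hx hp) (mem_span_singleton_self p)
  have hfin := finrank_sup_add_finrank_inf_eq (vectorSpan K s) (span K {p})
  rwa [hsup, hdisj.eq_bot, finrank_bot, add_zero, finrank_span_singleton hp0] at hfin

theorem finrank_vectorSpan_prod_singleton (s : Set V) (r : K) :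
    finrank K (vectorSpan K (s ×ˢ {r})) = finrank K (vectorSpan K s) := by
  have himage : s ×ˢ {r} = (AffineMap.id K V).prod (AffineMap.const K V r) '' s := by
    ext ⟨x, t⟩
    simp [eq_comm]
  rw [himage, ← AffineMap.map_vectorSpan]
  exact (equivMapOfInjective _ LinearMap.inl_injective _).finrank_eq.symm

end VectorSpan

variable {K V : Type*} [Field K] [LinearOrder K] [AddCommGroup V] [Module K V]

section ConicRep

/-- `c` writes `x` as a combination, with nonnegative coefficients, of finitely many members of
`T`. The coefficients are recorded as a function on all of `V`, so that representations over
different sets `T` can be compared. -/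
structure IsConicRep (T : Set V) (c : V →₀ K) (x : V) : Prop where
  nonneg : 0 ≤ c
  mem_supported : c ∈ supported K K T
  linearCombination_eq : linearCombination K id c = x

variable {S T : Set V} {c c' : V →₀ K} {x y b : V}

namespace IsConicRep

theorem mono (hc : IsConicRep S c x) (hST : S ⊆ T) : IsConicRep T c x :=
  ⟨hc.nonneg, Finsupp.supported_mono hST hc.mem_supported, hc.linearCombination_eq⟩

theorem mem_of_pos (hc : IsConicRep T c x) (hb : 0 < c b) : b ∈ T :=
  hc.mem_supported (Finsupp.mem_support_iff.2 hb.ne')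

theorem apply_eq (hc : IsConicRep T c x) (f : Dual K V) : f x = linearCombination K f c := by
  rw [← hc.linearCombination_eq, Finsupp.apply_linearCombination, Function.comp_id]

theorem eq_of_linearIndepOn (hT : LinearIndepOn K id T) (hc : IsConicRep T c x)
    (hc' : IsConicRep T c' x) : c = c' :=
  linearIndepOn_iffₛ.1 hT c hc.mem_supported c' hc'.mem_supported
    (hc.linearCombination_eq.trans hc'.linearCombination_eq.symm)

theorem degree_eq {ℓ : Dual K V} (hℓ : ∀ b ∈ T, ℓ b = 1) (hc : IsConicRep T c x) :
    c.degree = ℓ x := by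
  rw [hc.apply_eq, Finsupp.degree_apply, Finsupp.linearCombination_apply, Finsupp.sum]
  exact sum_congr rfl fun b hb ↦ by rw [hℓ b (hc.mem_supported hb), smul_eq_mul, mul_one]

variable [IsStrictOrderedRing K]

theorem add (hc : IsConicRep T c x) (hc' : IsConicRep T c' y) :
    IsConicRep T (c + c') (x + y) :=
  ⟨add_nonneg hc.nonneg hc'.nonneg, add_mem hc.mem_supported hc'.mem_supported, by
    rw [map_add, hc.linearCombination_eq, hc'.linearCombination_eq]⟩

theorem sub (hc : IsConicRep T c x) (hc' : IsConicRep T c' y) (hle : c' ≤ c) :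
    IsConicRep T (c - c') (x - y) :=
  ⟨sub_nonneg.2 hle, sub_mem hc.mem_supported hc'.mem_supported, by
    rw [map_sub, hc.linearCombination_eq, hc'.linearCombination_eq]⟩

end IsConicRep

variable [IsStrictOrderedRing K]

theorem mem_hull_iff_exists_isConicRep : x ∈ hull K T ↔ ∃ c : V →₀ K, IsConicRep T c x := by
  rw [mem_hull_set]
  exact exists_congr fun c ↦ ⟨fun ⟨hT, h0, hx⟩ ↦ ⟨h0, hT, hx⟩, fun h ↦ ⟨h.2, h.1, h.3⟩⟩

theorem isConicRep_single (hb : b ∈ T) : IsConicRep T (single b (1 : K)) b :=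
  ⟨Finsupp.single_nonneg.2 zero_le_one, Finsupp.single_mem_supported K 1 hb, by simp⟩

theorem isConicRep_sum_single {r : K} (hr : 0 ≤ r) (T : Finset V) :
    IsConicRep (T : Set V) (∑ t ∈ T, single t r) (r • ∑ t ∈ T, t) :=
  ⟨sum_nonneg fun _ _ ↦ Finsupp.single_nonneg.2 hr,
    sum_mem fun _ ht ↦ Finsupp.single_mem_supported K r ht, by simp [smul_sum]⟩

theorem exists_pos_of_mem_hull {g : Dual K V} (hx : x ∈ hull K T) (hgx : 0 < g x) :
    ∃ b ∈ T, 0 < g b := by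
  by_contra! hle
  obtain ⟨c, hc⟩ := mem_hull_iff_exists_isConicRep.1 hx
  rw [hc.apply_eq, Finsupp.linearCombination_apply] at hgx
  exact hgx.not_ge (sum_nonpos fun b hb ↦
    mul_nonpos_of_nonneg_of_nonpos (hc.nonneg b) (hle b (hc.mem_supported hb)))

theorem exists_dual_pos_of_notMem_hull (hT : LinearIndepOn K id T) (hx : x ∈ span K T)
    (hxT : x ∉ hull K T) : ∃ g : Dual K V, (∀ t ∈ T, g t ≤ 0) ∧ 0 < g x := by
  obtain ⟨c, hcT, rfl⟩ : ∃ c ∈ supported K K T, linearCombination K id c = x := by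
    rwa [← Set.image_id T, Finsupp.mem_span_image_iff_linearCombination] at hx
  obtain ⟨s, hs⟩ : ∃ s, c s < 0 := by
    by_contra! h0
    exact hxT (mem_hull_iff_exists_isConicRep.2 ⟨c, h0, hcT, rfl⟩)
  have hsT : s ∈ T := hcT (Finsupp.mem_support_iff.2 hs.ne)
  obtain ⟨f, hfs, hf⟩ : ∃ f : Dual K V, f s ≠ 0 ∧ span K (T \ {s}) ≤ LinearMap.ker f :=
    exists_le_ker_of_notMem (Set.image_id (T \ {s}) ▸ hT.notMem_span hsT)
  have hf0 : ∀ t ∈ T, t ≠ s → f t = 0 := fun t ht hts ↦ hf (subset_span ⟨ht, hts⟩)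
  have hfx : f (linearCombination K id c) = c s * f s := by
    rw [Finsupp.apply_linearCombination, Finsupp.linearCombination_apply]
    exact Finsupp.sum_eq_single s (fun t ht hts ↦ by
      simp [hf0 t (hcT (Finsupp.mem_support_iff.2 ht)) hts]) (by simp)
  refine ⟨-f s • f, fun t ht ↦ ?_, ?_⟩
  · rcases eq_or_ne t s with rfl | hts
    · simpa using mul_self_nonneg (f t)
    · simp [hf0 t ht hts]
  · rw [LinearMap.smul_apply, hfx, smul_eq_mul]
    nlinarith [mul_pos (neg_pos.2 hs) (mul_self_pos.2 hfs)]

theorem mem_hull_of_forall_exists_add_smul_mem (hT : LinearIndepOn K id T)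
    (hx : x ∈ span K T) (hy : ∀ ε : K, 0 < ε → ∃ δ, 0 < δ ∧ δ ≤ ε ∧ x + δ • y ∈ hull K T) :
    x ∈ hull K T := by
  by_contra hxT
  obtain ⟨g, hg, hgx⟩ := exists_dual_pos_of_notMem_hull hT hx hxT
  have hden : 0 < |g y| + 1 := by positivity
  obtain ⟨δ, hδ, hδle, hmem⟩ := hy (g x / (|g y| + 1)) (div_pos hgx hden)
  have hpos : 0 < g (x + δ • y) := by
    rw [map_add, map_smul, smul_eq_mul]
    nlinarith [(le_div_iff₀ hden).1 hδle, mul_le_mul_of_nonneg_left (neg_abs_le (g y)) hδ.le]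
  obtain ⟨t, ht, hgt⟩ := exists_pos_of_mem_hull hmem hpos
  exact (hg t ht).not_gt hgt

end ConicRep

section RegularTriangulation

variable {B : Finset V} {h : V → K} {f f' g : Dual K V} {c c' : V →₀ K} {x b : V}

/-- The polyhedron of all functionals below the heights `h` on `B`. Its vertices correspond to the
cells of the regular triangulation, induced by `h`, of the cone over `B`. -/
def dualPolyhedron (B : Finset V) (h : V → K) : Set (Dual K V) :=
  {f | ∀ b ∈ B, f b ≤ h b}

/-- The members of `B` where the functional `f` attains the height `h`, that is, the constraints of
`dualPolyhedron B h` that are active at `f`. -/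
def tightSet (B : Finset V) (h : V → K) (f : Dual K V) : Finset V :=
  {b ∈ B | f b = h b}

theorem mem_tightSet : b ∈ tightSet B h f ↔ b ∈ B ∧ f b = h b :=
  mem_filter

theorem tightSet_subset : tightSet B h f ⊆ B :=
  filter_subset _ _

theorem IsConicRep.apply_eq_of_tightSet (hc : IsConicRep (tightSet B h f : Set V) c x) :
    f x = linearCombination K h c := by
  rw [hc.apply_eq, Finsupp.linearCombination_apply, Finsupp.linearCombination_apply]
  exact Finsupp.sum_congr fun b hb ↦ by rw [(mem_tightSet.1 (hc.mem_supported hb)).2]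

theorem finite_setOf_apply_of_mem_span_tightSet (B : Finset V) (h : V → K) (x : V) :
    {r | ∃ f : Dual K V, x ∈ span K (tightSet B h f : Set V) ∧ f x = r}.Finite := by
  have hfin : (⋃ T ∈ B.powerset, {r | ∃ f : Dual K V, tightSet B h f = T ∧
      x ∈ span K (T : Set V) ∧ f x = r}).Finite := by
    refine Set.Finite.biUnion B.powerset.finite_toSet fun T _ ↦ Set.Subsingleton.finite ?_
    rintro _ ⟨f, hf, hxT, rfl⟩ _ ⟨g, hg, -, rfl⟩
    refine LinearMap.eqOn_span (f := f) (g := g) (fun t ht ↦ ?_) hxT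
    rw [(mem_tightSet.1 (hf.symm ▸ ht)).2, (mem_tightSet.1 (hg.symm ▸ ht)).2]
  refine hfin.subset ?_
  rintro _ ⟨f, hxf, rfl⟩
  exact Set.mem_biUnion (mem_powerset.2 tightSet_subset) ⟨f, rfl, hxf, rfl⟩

/-- Nonnegative heights on `B` in general position: no functional attains them on a linearly
dependent subset of `B`. -/
structure IsGenericHeight (B : Finset V) (h : V → K) : Prop where
  nonneg : ∀ b ∈ B, 0 ≤ h b
  linearIndepOn_tightSet : ∀ f : Dual K V, LinearIndepOn K id (tightSet B h f : Set V)

theorem IsGenericHeight.zero_mem_dualPolyhedron (hh : IsGenericHeight B h) :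
    0 ∈ dualPolyhedron B h :=
  hh.nonneg

variable [IsStrictOrderedRing K]

theorem exists_isGenericHeight (B : Finset V) : ∃ h : V → K, IsGenericHeight B h := by
  classical
  induction B using Finset.induction_on with
  | empty => exact ⟨0, by simp, fun f ↦ by simp [tightSet]⟩
  | insert b s hb ih =>
    obtain ⟨h, hh⟩ := ih
    obtain ⟨r, hr0, hr⟩ := (Set.Ici_infinite (0 : K)).exists_notMem_finite
      (finite_setOf_apply_of_mem_span_tightSet s h b)
    have hupdate : ∀ t ∈ s, Function.update h b r t = h t := fun t ht ↦
      Function.update_of_ne (ne_of_mem_of_not_mem ht hb) ..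
    have htight (f : Dual K V) : {t ∈ s | f t = Function.update h b r t} = tightSet s h f :=
      filter_congr fun t ht ↦ by rw [hupdate t ht]
    refine ⟨Function.update h b r, fun t ht ↦ ?_, fun f ↦ ?_⟩
    · rcases mem_insert.1 ht with rfl | ht
      · rwa [Function.update_self]
      · exact (hupdate t ht).symm ▸ hh.nonneg t ht
    · rw [tightSet, filter_insert, Function.update_self, htight]
      split_ifs with hfb
      · rw [coe_insert]
        exact (hh.linearIndepOn_tightSet f).id_insert fun hspan ↦ hr ⟨f, hspan, hfb⟩
      · exact hh.linearIndepOn_tightSet f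

theorem IsConicRep.apply_le (hc : IsConicRep (B : Set V) c x) (hf : f ∈ dualPolyhedron B h) :
    f x ≤ linearCombination K h c := by
  rw [hc.apply_eq, Finsupp.linearCombination_apply, Finsupp.linearCombination_apply]
  exact sum_le_sum fun b hb ↦ mul_le_mul_of_nonneg_left (hf b (hc.mem_supported hb)) (hc.nonneg b)

theorem IsConicRep.tightSet_of_le_apply (hc : IsConicRep (B : Set V) c x)
    (hf : f ∈ dualPolyhedron B h) (hle : linearCombination K h c ≤ f x) :
    IsConicRep (tightSet B h f : Set V) c x := by
  refine ⟨hc.nonneg, fun b hb ↦ ?_, hc.linearCombination_eq⟩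
  have heq := (hc.apply_le hf).antisymm hle
  rw [hc.apply_eq, Finsupp.linearCombination_apply, Finsupp.linearCombination_apply] at heq
  have hmul : c b * f b = c b * h b := (sum_eq_sum_iff_of_le fun t ht ↦
    mul_le_mul_of_nonneg_left (hf t (hc.mem_supported ht)) (hc.nonneg t)).1 heq b hb
  exact mem_tightSet.2
    ⟨hc.mem_supported hb, mul_left_cancel₀ (Finsupp.mem_support_iff.1 hb) hmul⟩

theorem IsGenericHeight.eq_of_isConicRep_tightSet (hh : IsGenericHeight B h)
    (hf : f ∈ dualPolyhedron B h) (hf' : f' ∈ dualPolyhedron B h)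
    (hc : IsConicRep (tightSet B h f : Set V) c x)
    (hc' : IsConicRep (tightSet B h f' : Set V) c' x) : c = c' := by
  refine hc.eq_of_linearIndepOn (hh.linearIndepOn_tightSet f)
    ((hc'.mono tightSet_subset).tightSet_of_le_apply hf ?_)
  calc linearCombination K h c' = f' x := hc'.apply_eq_of_tightSet.symm
    _ ≤ linearCombination K h c := (hc.mono tightSet_subset).apply_le hf'
    _ = f x := hc.apply_eq_of_tightSet.symm

theorem exists_add_smul_mem_dualPolyhedron (hf : f ∈ dualPolyhedron B h)
    (hg : ∃ b ∈ B, 0 < g b) : ∃ r : K, 0 ≤ r ∧ f + r • g ∈ dualPolyhedron B h ∧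
      ∃ b ∈ tightSet B h (f + r • g), 0 < g b := by
  obtain ⟨b, hb, hmin⟩ := exists_min_image {b ∈ B | 0 < g b} (fun b ↦ (h b - f b) / g b)
    (by simpa [Finset.Nonempty] using hg)
  obtain ⟨hbB, hgb⟩ := mem_filter.1 hb
  have hr : 0 ≤ (h b - f b) / g b := div_nonneg (sub_nonneg.2 (hf b hbB)) hgb.le
  refine ⟨(h b - f b) / g b, hr, fun t ht ↦ ?_, b, mem_tightSet.2 ⟨hbB, ?_⟩, hgb⟩
  · rcases le_or_gt (g t) 0 with hgt | hgt
    · exact (add_le_of_nonpos_right (mul_nonpos_of_nonneg_of_nonpos hr hgt)).trans (hf t ht)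
    · exact le_sub_iff_add_le'.1 ((le_div_iff₀ hgt).1 (hmin t (mem_filter.2 ⟨ht, hgt⟩)))
  · simp [hgb.ne']

theorem exists_le_ker_apply_nonneg_of_notMem {W : Submodule K V} (hx : x ∈ hull K (B : Set V))
    (hb : b ∈ B) (hbW : b ∉ W) :
    ∃ g : Dual K V, W ≤ LinearMap.ker g ∧ 0 ≤ g x ∧ ∃ t ∈ B, 0 < g t := by
  obtain ⟨g, hgb, hgW⟩ := exists_le_ker_of_notMem hbW
  have hnegW : W ≤ LinearMap.ker (-g) := fun w hw ↦ by simpa using hgW hw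
  rcases lt_trichotomy (g x) 0 with hgx | hgx | hgx
  · have hpos : 0 < (-g) x := neg_pos.2 hgx
    exact ⟨-g, hnegW, hpos.le, exists_pos_of_mem_hull hx hpos⟩
  · rcases lt_or_gt_of_ne hgb with hlt | hgt
    · exact ⟨-g, hnegW, (neg_eq_zero.2 hgx).ge, b, hb, neg_pos.2 hlt⟩
    · exact ⟨g, hgW, hgx.ge, b, hb, hgt⟩
  · exact ⟨g, hgW, hgx.le, exists_pos_of_mem_hull hx hgx⟩

theorem exists_vertex_ge (hx : x ∈ hull K (B : Set V)) (hf : f ∈ dualPolyhedron B h) :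
    ∃ f' ∈ dualPolyhedron B h, f x ≤ f' x ∧
      span K (tightSet B h f' : Set V) = span K (B : Set V) := by
  obtain ⟨f', ⟨hf', hle⟩, hmax⟩ := Set.Finite.exists_maximalFor' (tightSet B h)
    {f' | f' ∈ dualPolyhedron B h ∧ f x ≤ f' x}
    (B.powerset.finite_toSet.subset
      (Set.image_subset_iff.2 fun _ _ ↦ mem_powerset.2 tightSet_subset)) ⟨f, hf, le_rfl⟩
  refine ⟨f', hf', hle, (span_mono (mod_cast tightSet_subset)).antisymm (span_le.2 ?_)⟩
  by_contra hnot
  obtain ⟨b, hb, hbspan⟩ := Set.not_subset.1 hnot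
  obtain ⟨g, hgker, hgx, hgpos⟩ := exists_le_ker_apply_nonneg_of_notMem hx hb hbspan
  have hg0 : ∀ t ∈ tightSet B h f', g t = 0 := fun t ht ↦ hgker (subset_span ht)
  obtain ⟨r, hr, hmem, t, ht, hgt⟩ := exists_add_smul_mem_dualPolyhedron hf' hgpos
  have hsub : tightSet B h f' ⊆ tightSet B h (f' + r • g) := fun t ht ↦
    mem_tightSet.2 ⟨tightSet_subset ht, by simp [hg0 t ht, (mem_tightSet.1 ht).2]⟩
  have htf' : t ∈ tightSet B h f' :=
    hmax ⟨hmem, hle.trans (le_add_of_nonneg_right (mul_nonneg hr hgx))⟩ hsub ht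
  exact hgt.ne' (hg0 t htf')

theorem IsGenericHeight.exists_vertex_mem_hull (hh : IsGenericHeight B h)
    (hx : x ∈ hull K (B : Set V)) :
    ∃ f ∈ dualPolyhedron B h, span K (tightSet B h f : Set V) = span K (B : Set V) ∧
      x ∈ hull K (tightSet B h f : Set V) := by
  have hxspan : x ∈ span K (B : Set V) := hull_le_span _ _ hx
  obtain ⟨f, ⟨hf, hspan⟩, hmax⟩ := Set.Finite.exists_maximalFor' (fun f : Dual K V ↦ f x)
    {f | f ∈ dualPolyhedron B h ∧ span K (tightSet B h f : Set V) = span K (B : Set V)}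
    ((finite_setOf_apply_of_mem_span_tightSet B h x).subset (by
      rintro _ ⟨f, ⟨-, hspan⟩, rfl⟩
      exact ⟨f, hspan ▸ hxspan, rfl⟩))
    (let ⟨f, hf, _, hspan⟩ := exists_vertex_ge hx hh.zero_mem_dualPolyhedron
    ⟨f, hf, hspan⟩)
  refine ⟨f, hf, hspan, ?_⟩
  by_contra hxT
  obtain ⟨g, hg, hgx⟩ :=
    exists_dual_pos_of_notMem_hull (hh.linearIndepOn_tightSet f) (hspan ▸ hxspan) hxT
  obtain ⟨r, hr, hmem, b, hb, hgb⟩ :=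
    exists_add_smul_mem_dualPolyhedron hf (exists_pos_of_mem_hull hx hgx)
  have hrpos : 0 < r := hr.lt_of_ne' fun hr0 ↦ (hg b (by simpa [hr0] using hb)).not_gt hgb
  obtain ⟨f', hf', hle, hspan'⟩ := exists_vertex_ge hx hmem
  have hlt : f x < f' x := (lt_add_of_pos_right (f x) (mul_pos hrpos hgx)).trans_le hle
  exact (hmax ⟨hf', hspan'⟩ hlt.le).not_gt hlt

end RegularTriangulation

section ConicTriangulation

variable [IsStrictOrderedRing K]

variable {B T T' T₀ : Finset V} {𝒯 : Finset (Finset V)} {ℓ : Dual K V} {c c' : V →₀ K}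
  {a a' b b' u v x y z : V}

variable (K) in
/-- `𝒯` is the set of maximal cells of a triangulation, with vertices in `B`, of the convex cone
over `B`. That cells meet along common faces is expressed by the uniqueness of the conic
representation of a vector over the cells containing it. -/
structure IsConicTriangulation (B : Finset V) (𝒯 : Finset (Finset V)) : Prop where
  subset : ∀ T ∈ 𝒯, T ⊆ B
  linearIndepOn : ∀ T ∈ 𝒯, LinearIndepOn K id (T : Set V)
  span_eq : ∀ T ∈ 𝒯, span K (T : Set V) = span K (B : Set V)
  exists_mem_hull : ∀ x ∈ hull K (B : Set V), ∃ T ∈ 𝒯, x ∈ hull K (T : Set V)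
  conicRep_unique : ∀ T ∈ 𝒯, ∀ T' ∈ 𝒯, ∀ (c c' : V →₀ K) (x : V),
    IsConicRep (T : Set V) c x → IsConicRep (T' : Set V) c' x → c = c'

variable (K) in
theorem exists_isConicTriangulation (B : Finset V) :
    ∃ 𝒯 : Finset (Finset V), IsConicTriangulation K B 𝒯 := by
  classical
  obtain ⟨h, hh⟩ := exists_isGenericHeight (K := K) B
  let 𝒯 : Finset (Finset V) := {T ∈ B.powerset | ∃ f ∈ dualPolyhedron B h,
    tightSet B h f = T ∧ span K (T : Set V) = span K (B : Set V)}
  have hcell : ∀ T ∈ 𝒯, ∃ f ∈ dualPolyhedron B h,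
      tightSet B h f = T ∧ span K (T : Set V) = span K (B : Set V) :=
    fun T hT ↦ (mem_filter.1 hT).2
  refine ⟨𝒯, fun T hT ↦ mem_powerset.1 (mem_filter.1 hT).1, fun T hT ↦ ?_, fun T hT ↦ ?_,
    fun x hx ↦ ?_, fun T hT T' hT' c c' x hc hc' ↦ ?_⟩
  · obtain ⟨f, -, rfl, -⟩ := hcell T hT
    exact hh.linearIndepOn_tightSet f
  · obtain ⟨-, -, -, hspan⟩ := hcell T hT
    exact hspan
  · obtain ⟨f, hf, hspan, hx⟩ := hh.exists_vertex_mem_hull hx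
    exact ⟨_, mem_filter.2 ⟨mem_powerset.2 tightSet_subset, f, hf, rfl, hspan⟩, hx⟩
  · obtain ⟨f, hf, rfl, -⟩ := hcell T hT
    obtain ⟨f', hf', rfl, -⟩ := hcell T' hT'
    exact hh.eq_of_isConicRep_tightSet hf hf' hc hc'

namespace IsConicTriangulation

theorem card_eq (h𝒯 : IsConicTriangulation K B 𝒯) (hT : T ∈ 𝒯) :
    #T = finrank K (span K (B : Set V)) := by
  rw [← h𝒯.span_eq T hT]
  exact (finrank_span_finset_eq_card (h𝒯.linearIndepOn T hT)).symm

theorem exists_frequently_add_smul_mem_hull (h𝒯 : IsConicTriangulation K B 𝒯)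
    (hx : x ∈ hull K (B : Set V)) (hz : z ∈ hull K (B : Set V)) :
    ∃ T ∈ 𝒯, ∀ ε : K, 0 < ε → ∃ δ, 0 < δ ∧ δ ≤ ε ∧ x + δ • z ∈ hull K (T : Set V) := by
  by_contra! hnot
  choose! e he hmem using hnot
  have hne : 𝒯.Nonempty := (h𝒯.exists_mem_hull x hx).imp fun _ ↦ And.left
  obtain ⟨T₁, hT₁, hmin⟩ := exists_min_image 𝒯 e hne
  obtain ⟨T, hT, hxT⟩ := h𝒯.exists_mem_hull (x + e T₁ • z)
    (add_mem hx ((hull K (B : Set V)).smul_mem (he T₁ hT₁).le hz))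
  exact hmem T hT (e T₁) (he T₁ hT₁) (hmin T hT) hxT

theorem exists_segment_subset_hull (h𝒯 : IsConicTriangulation K B 𝒯)
    (hx : x ∈ hull K (B : Set V)) (hz : z ∈ hull K (B : Set V)) :
    ∃ T ∈ 𝒯, ∃ ε : K, 0 < ε ∧ ∀ δ, 0 ≤ δ → δ ≤ ε → x + δ • z ∈ hull K (T : Set V) := by
  obtain ⟨T, hT, hfreq⟩ := h𝒯.exists_frequently_add_smul_mem_hull hx hz
  have hxT : x ∈ hull K (T : Set V) := mem_hull_of_forall_exists_add_smul_mem
    (h𝒯.linearIndepOn T hT) (h𝒯.span_eq T hT ▸ hull_le_span _ _ hx) hfreq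
  obtain ⟨ε, hε, -, hmem⟩ := hfreq 1 one_pos
  refine ⟨T, hT, ε, hε, fun δ hδ hle ↦ ?_⟩
  have := (hull K (T : Set V)).convex.add_smul_mem hxT hmem
    ⟨div_nonneg hδ hε.le, (div_le_one hε).2 hle⟩
  rwa [smul_smul, div_mul_cancel₀ _ hε.ne'] at this

theorem single_le_of_add_eq_add (h𝒯 : IsConicTriangulation K B 𝒯) (hT : T ∈ 𝒯) (hT' : T' ∈ 𝒯)
    (hc : IsConicRep (T : Set V) c x) (hc' : IsConicRep (T' : Set V) c' y) (hb : b ∈ T)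
    (hb' : b' ∈ T') (hadd : x + b = y + b') (hne : b ≠ b') : single b' 1 ≤ c :=
  single_le_of_add_single_eq hc.nonneg hc'.nonneg (h𝒯.conicRep_unique T hT T' hT' _ _ _
    (hc.add (isConicRep_single hb)) (hadd ▸ hc'.add (isConicRep_single hb'))) hne

theorem eq_of_add_eq_add (h𝒯 : IsConicTriangulation K B 𝒯) (hℓ : ∀ t ∈ B, ℓ t = 1)
    (hT : T ∈ 𝒯) (hT' : T' ∈ 𝒯) (ha : a ∈ hull K (T : Set V)) (ha' : a' ∈ hull K (T' : Set V))
    (hℓa : ℓ a = 1) (hb : b ∈ T) (hb' : b' ∈ T') (hadd : a + b = a' + b') (hne : b ≠ b') :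
    a = b' := by
  obtain ⟨c, hc⟩ := mem_hull_iff_exists_isConicRep.1 ha
  obtain ⟨c', hc'⟩ := mem_hull_iff_exists_isConicRep.1 ha'
  have hdeg : c.degree = 1 := (hc.degree_eq fun t ht ↦ hℓ t (h𝒯.subset T hT ht)).trans hℓa
  have hcb' : single b' 1 = c := eq_of_le_of_degree_eq
    (h𝒯.single_le_of_add_eq_add hT hT' hc hc' hb hb' hadd hne) (by simp [hdeg])
  simpa [← hcb'] using hc.linearCombination_eq.symm

theorem eq_of_smul_sum_mem_hull (h𝒯 : IsConicTriangulation K B 𝒯) (hT₀ : T₀ ∈ 𝒯) (hT : T ∈ 𝒯)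
    {δ : K} (hδ : 0 < δ) (hmem : δ • ∑ t ∈ T₀, t ∈ hull K (T : Set V)) : T₀ = T := by
  classical
  obtain ⟨c, hc⟩ := mem_hull_iff_exists_isConicRep.1 hmem
  have hceq : ∑ t ∈ T₀, single t δ = c :=
    h𝒯.conicRep_unique T₀ hT₀ T hT _ _ _ (isConicRep_sum_single hδ.le T₀) hc
  refine eq_of_subset_of_card_le (fun t ht ↦ hc.mem_of_pos ?_)
    ((h𝒯.card_eq hT).trans (h𝒯.card_eq hT₀).symm).le
  simpa [← hceq, Finsupp.finsetSum_apply, Finsupp.single_apply, ht] using hδ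

theorem mem_of_add_smul_sum_mem_hull (h𝒯 : IsConicTriangulation K B 𝒯) (hT₀ : T₀ ∈ 𝒯)
    (hT : T ∈ 𝒯) (hT' : T' ∈ 𝒯) {δ : K} (hδ : 0 < δ)
    (hu : u + δ • ∑ t ∈ T₀, t ∈ hull K (T : Set V))
    (hv : v + δ • ∑ t ∈ T₀, t ∈ hull K (T' : Set V)) (hvT : v ∈ T) (huT' : u ∈ T')
    (hne : u ≠ v) : u ∈ T₀ ∧ v ∈ T₀ := by
  obtain ⟨c, hc⟩ := mem_hull_iff_exists_isConicRep.1 hu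
  obtain ⟨c', hc'⟩ := mem_hull_iff_exists_isConicRep.1 hv
  have hle : single u 1 ≤ c :=
    h𝒯.single_le_of_add_eq_add hT hT' hc hc' hvT huT' (by abel) hne.symm
  have huT : u ∈ T := hc.mem_of_pos (one_pos.trans_le (by simpa using hle u))
  have hsub := hc.sub (isConicRep_single (mem_coe.2 huT)) hle
  rw [add_sub_cancel_left] at hsub
  rw [h𝒯.eq_of_smul_sum_mem_hull hT₀ hT hδ (mem_hull_iff_exists_isConicRep.2 ⟨_, hsub⟩)]
  exact ⟨huT, hvT⟩

theorem exists_cells_of_add_eq_add (h𝒯 : IsConicTriangulation K B 𝒯) (hℓ : ∀ t ∈ B, ℓ t = 1)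
    {A : Set V} (hA : ∀ a ∈ A, a ∈ hull K (B : Set V)) (hℓA : ∀ a ∈ A, ℓ a = 1) (hT₀ : T₀ ∈ 𝒯) :
    ∃ T : V → Finset V, (∀ a ∈ A, T a ∈ 𝒯) ∧
      ∀ a ∈ A, ∀ b ∈ T a, ∀ a' ∈ A, ∀ b' ∈ T a', a + b = a' + b' → b ≠ b' →
        (b, a) = (a', b') ∧ a ∈ T₀ ∧ b ∈ T₀ := by
  have hbary : ∑ t ∈ T₀, t ∈ hull K (B : Set V) :=
    sum_mem fun t ht ↦ subset_hull (h𝒯.subset T₀ hT₀ ht)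
  choose! T hT ε hε hseg using fun a (ha : a ∈ A) ↦
    h𝒯.exists_segment_subset_hull (hA a ha) hbary
  have hmem : ∀ a ∈ A, a ∈ hull K (T a : Set V) := fun a ha ↦ by
    simpa using hseg a ha 0 le_rfl (hε a ha).le
  refine ⟨T, hT, fun a ha b hb a' ha' b' hb' hadd hne ↦ ?_⟩
  obtain rfl : a = b' := h𝒯.eq_of_add_eq_add hℓ (hT a ha) (hT a' ha') (hmem a ha)
    (hmem a' ha') (hℓA a ha) hb hb' hadd hne
  obtain rfl : a' = b := h𝒯.eq_of_add_eq_add hℓ (hT a' ha') (hT a ha) (hmem a' ha')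
    (hmem a ha) (hℓA a' ha') hb' hb hadd.symm hne.symm
  have hδ : 0 < min (ε a) (ε a') := lt_min (hε a ha) (hε a' ha')
  exact ⟨rfl, h𝒯.mem_of_add_smul_sum_mem_hull hT₀ (hT a ha) (hT a' ha') hδ
    (hseg a ha _ hδ.le (min_le_left _ _)) (hseg a' ha' _ hδ.le (min_le_right _ _)) hb hb'
    hne.symm⟩

end IsConicTriangulation

end ConicTriangulation

section SumsetBound

variable [IsStrictOrderedRing K]

theorem card_mul_finrank_span_le_of_forall_apply_eq_one [DecidableEq V] {A B : Finset V}
    {ℓ : Dual K V} (hℓ : ∀ b ∈ B, ℓ b = 1) (hA : (A : Set V) ⊆ convexHull K (B : Set V)) :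
    #A * finrank K (span K (B : Set V)) ≤
      #(A + B) + (finrank K (span K (B : Set V))).choose 2 := by
  have hhull : ∀ a ∈ A, a ∈ hull K (B : Set V) := fun a ha ↦
    convexHull_min subset_hull (hull K (B : Set V)).convex (hA ha)
  have hℓA : ∀ a ∈ A, ℓ a = 1 := fun a ha ↦
    convexHull_min (t := {x | ℓ x = 1}) (fun b hb ↦ hℓ b hb)
      (convex_hyperplane ℓ.isLinear 1) (hA ha)
  obtain ⟨𝒯, h𝒯⟩ := exists_isConicTriangulation K B
  obtain ⟨T₀, hT₀, -⟩ := h𝒯.exists_mem_hull 0 (zero_mem _)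
  obtain ⟨T, hT, hswap⟩ := h𝒯.exists_cells_of_add_eq_add hℓ hhull hℓA hT₀
  set S : Finset (V × V) := (A.sigma T).map (Equiv.sigmaEquivProd V V).toEmbedding with hS
  have hmemS : ∀ p, p ∈ S ↔ p.1 ∈ A ∧ p.2 ∈ T p.1 := by simp [hS]
  calc #A * finrank K (span K (B : Set V)) = #S := by
        rw [hS, card_map, card_sigma, sum_congr rfl fun a ha ↦ h𝒯.card_eq (hT a ha), sum_const,
          smul_eq_mul]
    _ ≤ #(S.image fun p ↦ p.1 + p.2) + (#T₀).choose 2 := by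
        refine card_le_card_image_add_choose_two fun p hp q hq hadd ↦ ?_
        obtain ⟨⟨hpA, hpT⟩, hqA, hqT⟩ := (hmemS p).1 hp, (hmemS q).1 hq
        rcases eq_or_ne p.2 q.2 with heq | hne
        · exact Or.inl (Prod.ext (by simpa [heq] using hadd) heq)
        · obtain ⟨hpq, hmem₁, hmem₂⟩ := hswap _ hpA _ hpT _ hqA _ hqT hadd hne
          exact Or.inr ⟨hpq, mem_product.2 ⟨hmem₁, hmem₂⟩⟩
    _ ≤ #(A + B) + (finrank K (span K (B : Set V))).choose 2 := by
        rw [h𝒯.card_eq hT₀]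
        gcongr
        exact image_subset_iff.2 fun p hp ↦ add_mem_add ((hmemS p).1 hp).1
          (h𝒯.subset _ (hT _ ((hmemS p).1 hp).1) ((hmemS p).1 hp).2)

theorem card_mul_finrank_vectorSpan_add_one_le [DecidableEq V] {A B : Finset V}
    (hA : (A : Set V) ⊆ convexHull K (B : Set V)) :
    #A * (finrank K (vectorSpan K (B : Set V)) + 1) ≤
      #(A + B) + (finrank K (vectorSpan K (B : Set V)) + 1).choose 2 := by
  rcases B.eq_empty_or_nonempty with rfl | hB
  · obtain rfl : A = ∅ := by simpa using hA
    simp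
  have hℓ : ∀ p ∈ (B : Set V) ×ˢ {(1 : K)}, LinearMap.snd K V K p = 1 := fun p hp ↦ hp.2
  have hfin : FiniteDimensional K (vectorSpan K ((B : Set V) ×ˢ {(1 : K)})) :=
    finiteDimensional_vectorSpan_of_finite K (B.finite_toSet.prod (Set.finite_singleton 1))
  have hrank : finrank K (span K ((B : Set V) ×ˢ {(1 : K)})) =
      finrank K (vectorSpan K (B : Set V)) + 1 := by
    rw [finrank_span_eq_finrank_vectorSpan_add_one hℓ (hB.to_set.prod (Set.singleton_nonempty 1)),
      finrank_vectorSpan_prod_singleton]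
  have hconv : ((A ×ˢ {1} : Finset (V × K)) : Set (V × K)) ⊆
      convexHull K ((B ×ˢ {1} : Finset (V × K)) : Set (V × K)) := by
    rw [coe_product, coe_product, coe_singleton, convexHull_prod, convexHull_singleton]
    exact Set.prod_mono_left hA
  have hlift := card_mul_finrank_span_le_of_forall_apply_eq_one (ℓ := LinearMap.snd K V K)
    (fun p hp ↦ mem_singleton.1 (mem_product.1 hp).2) hconv
  rwa [product_add_product_comm, singleton_add_singleton, coe_product, coe_singleton, hrank,
    card_product, card_product, card_singleton, card_singleton, mul_one, mul_one] at hlift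

theorem theorem3_general {A B : Set V} (hA : A.Finite) (hB : B.Finite)
    (hsub : A ⊆ convexHull K B) :
    ((A + B).ncard : ℝ) ≥ (A.ncard : ℝ) * ((finrank K (vectorSpan K B) : ℝ) + 1) -
      (finrank K (vectorSpan K B) : ℝ) * ((finrank K (vectorSpan K B) : ℝ) + 1) / 2 := by
  classical
  lift A to Finset V using hA
  lift B to Finset V using hB
  have hnat := card_mul_finrank_vectorSpan_add_one_le hsub
  rw [← Finset.coe_add, Set.ncard_coe_finset, Set.ncard_coe_finset]
  rify at hnat
  rw [Nat.cast_choose_two] at hnat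
  push_cast at hnat
  linarith

end SumsetBound

theorem IsProperDimensional.finrank_vectorSpan {d : ℕ} {B : Set (EuclideanSpace ℝ (Fin d))}
    (hB : IsProperDimensional B) : finrank ℝ (vectorSpan ℝ B) = d := by
  suffices htop : vectorSpan ℝ B = ⊤ by rw [htop, finrank_top, finrank_euclideanSpace_fin]
  by_contra hne
  obtain ⟨f, hf, hker⟩ := exists_le_ker_of_lt_top _ (lt_top_iff_ne_top.2 hne)
  obtain ⟨c, hc⟩ : ∃ c, ∀ b ∈ B, f b = c := by
    rcases B.eq_empty_or_nonempty with rfl | ⟨p, hp⟩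
    · simp
    · exact ⟨f p, fun b hb ↦ sub_eq_zero.1 <|
        (map_sub f b p).symm.trans (hker (vsub_mem_vectorSpan ℝ hb hp))⟩
  exact hB _ ⟨f, c, hf, rfl⟩ hc

theorem theorem3 (d m : ℕ) (A B : Set (EuclideanSpace ℝ (Fin d)))
    (hA : A.Finite) (hB : B.Finite) (hm : A.ncard = m)
    (hproper : IsProperDimensional B) (hsub : A ⊆ convexHull ℝ B) :
    ((A + B).ncard : ℝ) ≥ (m : ℝ) * ((d : ℝ) + 1) - (d : ℝ) * ((d : ℝ) + 1) / 2 := by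
  simpa only [hm, hproper.finrank_vectorSpan] using theorem3_general hA hB hsub
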